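/- Let $n\ge 0$, let $[z_0:z_1:\cdots:z_n]$ be the homogeneous coordinates of $\mathbb{C}P^n$, and let $$X=\{[1:z_1:\cdots:z_n]\in\mathbb{C}P^n \mid z_i\neq 0\ (1\le i\le n)\}\cong(\mathbb{C}^*)^n,$$ with the restriction of the Fubini–Study metric. For a holomorphic map $f=[1:f_1:\cdots:f_n]:\mathbb{C}\to X$ put $|df|(z)=\sqrt2\,|df(\partial/\partial z)|$, where $\partial/\partial z=\frac12(\partial/\partial x-\sqrt{-1}\,\partial/\partial y)$; with the metric normalized as usual in Nevanlinna theory this is $$|df|^2(z)=\frac1\pi\cdot\frac{\bigl(1+\sum_i|f_i|^2\bigr)\sum_i|f_i'|^2-\bigl|\sum_i\overline{f_i}\,f_i'\bigr|^2}{\bigl(1+\sum_i|f_i|^2\bigr)^2}=\frac1{4\pi}\Delta\log\Bigl(1+\sum_{i}|f_i(z)|^2\Bigr).$$ Theorem. Let $f:\mathbb{C}\to X$ be a holomorphic map and let $m\ge 0$ be an integer. Then the following are equivalent. (a) There is a constant $C>0$ such that $|df|(z)\le C|z|^m$ for all $z\in\mathbb{C}$ with $|z|\ge 1$. (b) There are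 polynomials $g_1,\dots,g_n\in\mathbb{C}[z]$ with $\deg g_i\le m+1$ for $1\le i\le n$ such that $f(z)=[1:e^{g_1(z)}:\cdots:e^{g_n(z)}]$ for all $z\in\mathbb{C}$. -/

import Mathlib

open scoped LinearAlgebra.Projectivization

namespace TorusCurve

/-- Complex projective space of dimension `n`: the lines of `ℂ^(n+1)`, with homogeneous
coordinates indexed by `0, ..., n`. -/
abbrev CP (n : ℕ) : Type := ℙ ℂ (Fin (n + 1) → ℂ)

/-- The standard open set of the points whose `i`-th homogeneous coordinate does not vanish. -/
def affineOpen {n : ℕ} (i : Fin (n + 1)) : Set (CP n) :=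
  {p | ∃ (v : Fin (n + 1) → ℂ) (hv : v ≠ 0), v i ≠ 0 ∧ p = Projectivization.mk ℂ v hv}

/-- The standard affine chart on `affineOpen i`: it sends `[v_0 : ... : v_n]` to the vector of the
quotients `v_j / v_i`, `j ≠ i`, in increasing order of `j`. (Outside `affineOpen i` its value
is `0`.) -/
noncomputable def affineChart {n : ℕ} (i : Fin (n + 1)) : CP n → EuclideanSpace ℂ (Fin n) :=
  Projectivization.lift
    (fun v => WithLp.toLp 2 fun j => v.1 (i.succAbove j) / v.1 i)
    (by
      rintro ⟨a, ha⟩ ⟨b, hb⟩ t h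
      have h' : a = t • b := h
      have ht : t ≠ 0 := by
        rintro rfl
        exact ha (by simpa using h')
      subst h'
      congr 1
      funext j
      simp [mul_div_mul_left _ _ ht])

/-- A map from `ℂ` to projective space is holomorphic if, for each chart of the standard
atlas, the set of the points that are sent into the domain of the chart is open and the map is
holomorphic there in the coordinates of the chart. -/
def IsHolomorphic {n : ℕ} (f : ℂ → CP n) : Prop :=
  ∀ i : Fin (n + 1), IsOpen (f ⁻¹' affineOpen i) ∧
    DifferentiableOn ℂ (fun z => affineChart i (f z)) (f ⁻¹' affineOpen i)

theorem cons_one_ne_zero {n : ℕ} (w : Fin n → ℂ) : (Fin.cons 1 w : Fin (n + 1) → ℂ) ≠ 0 :=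
  fun h => one_ne_zero (congrFun h 0)

/-- The point `[1 : w_1 : ... : w_n]`. -/
noncomputable def point {n : ℕ} (w : Fin n → ℂ) : CP n :=
  Projectivization.mk ℂ (Fin.cons 1 w) (cons_one_ne_zero w)

/-- The algebraic torus `{[1 : w_1 : ... : w_n] | w_i ≠ 0}` in projective space. -/
def torus (n : ℕ) : Set (CP n) :=
  {p | ∃ w : Fin n → ℂ, (∀ i, w i ≠ 0) ∧ p = point w}

/-- The Fubini–Study Hermitian inner product of the `(1,0)`-vectors `∑ v_j ∂/∂z_j` and
`∑ w_j ∂/∂z_j` at the point with coordinates `u` of an affine chart. The normalization is such that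
the real metric at `u = 0` is `1/π` times the Euclidean one, for which `∂/∂z_j` has
length `1/√2`. -/
noncomputable def fubiniStudy {n : ℕ} (u v w : EuclideanSpace ℂ (Fin n)) : ℂ :=
  1 / (2 * (Real.pi : ℂ)) *
    (((1 + (‖u‖ : ℂ) ^ 2) * inner ℂ v w - inner ℂ v u * inner ℂ u w) / (1 + (‖u‖ : ℂ) ^ 2) ^ 2)

/-- The norm `|df|(z) = √2 |df(∂/∂z)|` of the differential of a holomorphic curve in the torus, in the
Fubini–Study metric. It is computed in the chart `[1 : w_1 : ... : w_n] ↦ (w_1, ..., w_n)`, whose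
domain contains the torus, and in which `df(∂/∂z) = ∑ f_j'(z) ∂/∂w_j`. -/
noncomputable def normDiff {n : ℕ} (f : ℂ → CP n) (z : ℂ) : ℝ :=
  let u := affineChart 0 (f z)
  let v := deriv (fun ζ => affineChart 0 (f ζ)) z
  √2 * √(fubiniStudy u v v).re

end TorusCurve

/-! Write `f = [1 : e^{g_1} : ... : e^{g_n}]` with entire `g_i`, and put `g_0 = 0`. With the weights
`|e^{g_i}|²`, `0 ≤ i ≤ n`, the quantity `π|df|²` is the variance of the numbers `g_i'`
(`normDiff_eq`). A variance is at most `∑ |g_i'|²`, so polynomials of degree at most `m + 1` give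
the growth bound. Conversely, the variance is a quarter of the Laplacian of `log ∑ |e^{g_i}|²`. A
polynomial bound on it therefore bounds the circle means of this logarithm polynomially; Green's
formula is applied after the substitution `z = e^w`, which turns annuli into periodic strips. As
`g_0 = 0`, the logarithm dominates both `0` and `2 Re g_i`, so the means of `(Re g_i)⁺` grow
polynomially, and estimates of Taylor coefficients make `g_i` a polynomial
(`exists_polynomial_of_spread_le`). The degree obtained in this way is too large, and a second
argument sharpens it (`natDegree_le_of_gram_le`). Suppose that the maximal degree `k` exceeds `m +
1`. Split the indices according to whether the coefficient of `z^k` equals a fixed one of maximal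
modulus. On a large circle each of the two classes outweighs the other in some direction, so at some
point they have equal mass. There the variance is at least a quarter of the least `|g_i' - g_j'|²`
between the classes, of order `|z|^(2(k-1))`, which is too large. -/

namespace TorusCurve

open Polynomial Filter Topology Bornology

/-! ### Weighted variance and the Lagrange identity -/

section Gram

variable {ι : Type*} [Fintype ι]

/-- The Gram determinant of the vectors `(1)` and `(d i)` with respect to the weights `e i`. -/
noncomputable def gram (e : ι → ℝ) (d : ι → ℂ) : ℝ :=
  (∑ i, e i) * ∑ i, e i * ‖d i‖ ^ 2 - ‖∑ i, (e i : ℂ) * d i‖ ^ 2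

theorem norm_sq_sum_eq_re (e : ι → ℝ) (d : ι → ℂ) :
    ‖∑ i, (e i : ℂ) * d i‖ ^ 2 =
      ∑ i, ∑ j, e i * e j * (d i * (starRingEnd ℂ) (d j)).re := by
  have h : ((‖∑ i, (e i : ℂ) * d i‖ ^ 2 : ℝ) : ℂ) =
      ∑ i, ∑ j, ((e i : ℂ) * (e j : ℂ)) * (d i * (starRingEnd ℂ) (d j)) := by
    rw [Complex.ofReal_pow, ← Complex.mul_conj', map_sum, Finset.sum_mul_sum]
    refine Finset.sum_congr rfl fun i _ => Finset.sum_congr rfl fun j _ => ?_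
    simp only [map_mul, Complex.conj_ofReal]
    ring
  have h' := congrArg Complex.re h
  rw [Complex.ofReal_re] at h'
  rw [h', Complex.re_sum]
  refine Finset.sum_congr rfl fun i _ => ?_
  rw [Complex.re_sum]
  refine Finset.sum_congr rfl fun j _ => ?_
  rw [← Complex.ofReal_mul, Complex.re_ofReal_mul]

/-- The Lagrange identity. -/
theorem two_mul_gram (e : ι → ℝ) (d : ι → ℂ) :
    2 * gram e d = ∑ i, ∑ j, e i * e j * ‖d i - d j‖ ^ 2 := by
  have h (i j : ι) : e i * e j * ‖d i - d j‖ ^ 2 = (e i * ‖d i‖ ^ 2) * e j +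
      e i * (e j * ‖d j‖ ^ 2) - 2 * (e i * e j * (d i * (starRingEnd ℂ) (d j)).re) := by
    rw [Complex.sq_norm, Complex.sq_norm, Complex.sq_norm, Complex.normSq_sub]
    ring
  simp only [h, Finset.sum_add_distrib, Finset.sum_sub_distrib, ← Finset.mul_sum]
  rw [gram, norm_sq_sum_eq_re]
  simp only [← Finset.sum_mul]
  ring

theorem gram_nonneg {e : ι → ℝ} (he : ∀ i, 0 ≤ e i) (d : ι → ℂ) : 0 ≤ gram e d := by
  have h := two_mul_gram e d
  have : 0 ≤ ∑ i, ∑ j, e i * e j * ‖d i - d j‖ ^ 2 :=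
    Finset.sum_nonneg fun i _ => Finset.sum_nonneg fun j _ =>
      mul_nonneg (mul_nonneg (he i) (he j)) (sq_nonneg _)
  linarith

/-- Drop the subtracted square and bound each weight by the total weight. -/
theorem gram_le {e : ι → ℝ} (he : ∀ i, 0 ≤ e i) (d : ι → ℂ) :
    gram e d ≤ (∑ i, e i) ^ 2 * ∑ i, ‖d i‖ ^ 2 := by
  have h : ∑ i, e i * ‖d i‖ ^ 2 ≤ (∑ i, e i) * ∑ i, ‖d i‖ ^ 2 := by
    rw [Finset.mul_sum]
    refine Finset.sum_le_sum fun i hi => mul_le_mul_of_nonneg_right ?_ (sq_nonneg _)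
    exact Finset.single_le_sum (fun j _ => he j) hi
  have := mul_le_mul_of_nonneg_left h (Finset.sum_nonneg fun i (_ : i ∈ Finset.univ) => he i)
  rw [gram]
  nlinarith [sq_nonneg ‖∑ i, (e i : ℂ) * d i‖]

/-- If the values of `d` on `A` are far from those on the complement of `A`, then the Gram
determinant is bounded below in terms of the masses of these two sets. -/
theorem mass_mul_mass_mul_le_gram [DecidableEq ι] {e : ι → ℝ} (he : ∀ i, 0 ≤ e i) (d : ι → ℂ)
    (A : Finset ι) {c : ℝ} (hc : ∀ i ∈ A, ∀ j ∉ A, c ≤ ‖d i - d j‖ ^ 2) :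
    (∑ i ∈ A, e i) * (∑ j ∈ Aᶜ, e j) * c ≤ gram e d := by
  have key (A : Finset ι) (hc : ∀ i ∈ A, ∀ j ∉ A, c ≤ ‖d i - d j‖ ^ 2) :
      (∑ i ∈ A, e i) * (∑ j ∈ Aᶜ, e j) * c ≤ ∑ i ∈ A, ∑ j, e i * e j * ‖d i - d j‖ ^ 2 := by
    rw [Finset.sum_mul_sum, Finset.sum_mul]
    refine Finset.sum_le_sum fun i hi => ?_
    rw [Finset.sum_mul]
    refine (Finset.sum_le_sum fun j hj => mul_le_mul_of_nonneg_left
      (hc i hi j (by simpa using hj)) (mul_nonneg (he i) (he j))).trans ?_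
    exact Finset.sum_le_sum_of_subset_of_nonneg (Finset.subset_univ _) fun j _ _ =>
      mul_nonneg (mul_nonneg (he i) (he j)) (sq_nonneg _)
  -- Each separated pair occurs in both orders in the Lagrange identity; the two contributions
  -- together cancel its factor 2.
  have h₁ := key A hc
  have h₂ := key Aᶜ fun i hi j hj => by
    rw [norm_sub_rev]
    exact hc j (by simpa using hj) i (by simpa using hi)
  have h₃ := two_mul_gram e d
  rw [← Finset.sum_add_sum_compl A] at h₃
  rw [compl_compl] at h₂
  nlinarith

end Gram

/-! ### Polynomial exponents: the sharp degree bound -/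

section Polynomials

/-- The quotient is the reflected polynomial evaluated at `z⁻¹`, and `z⁻¹` tends to `0`. -/
theorem tendsto_eval_div_pow {p : ℂ[X]} {k : ℕ} (hp : p.natDegree ≤ k) :
    Tendsto (fun z => p.eval z / z ^ k) (cobounded ℂ) (𝓝 (p.coeff k)) := by
  have h₁ : Tendsto (fun z : ℂ => (p.reflect k).eval z⁻¹) (cobounded ℂ) (𝓝 (p.coeff k)) := by
    have h := ((p.reflect k).continuous.tendsto 0).comp (tendsto_inv₀_cobounded (α := ℂ))
    have h0 : (p.reflect k).eval 0 = p.coeff k := by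
      rw [← coeff_zero_eq_eval_zero, coeff_reflect, revAt_zero]
    rwa [h0] at h
  refine h₁.congr' ?_
  filter_upwards [eventually_ne_cobounded (0 : ℂ)] with z hz
  let _ := invertibleOfNonzero hz
  have h := eval₂_reflect_mul_pow (RingHom.id ℂ) z k p hp
  rw [invOf_eq_inv] at h
  rw [eq_div_iff (pow_ne_zero k hz)]
  exact h

theorem eventually_mul_pow_lt_norm_eval {p : ℂ[X]} {m : ℕ} (hp : m < p.natDegree) (C : ℝ) :
    ∀ᶠ z in cobounded ℂ, C * ‖z‖ ^ m < ‖p.eval z‖ := by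
  have hp0 : p.leadingCoeff ≠ 0 := by
    rw [leadingCoeff_ne_zero]
    rintro rfl
    simp at hp
  have h₁ := (tendsto_eval_div_pow (le_refl p.natDegree)).norm
  have h₂ : Tendsto (fun z : ℂ => ‖z‖ ^ (p.natDegree - m)) (cobounded ℂ) atTop :=
    (tendsto_pow_atTop (by omega)).comp tendsto_norm_cobounded_atTop
  have h₃ := h₁.pos_mul_atTop (norm_pos_iff.2 hp0) h₂
  filter_upwards [h₃.eventually_gt_atTop C, eventually_ne_cobounded (0 : ℂ)] with z hz hz0
  have hz0' : 0 < ‖z‖ := norm_pos_iff.2 hz0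
  have : ‖p.eval z‖ = ‖p.eval z / z ^ p.natDegree‖ * ‖z‖ ^ (p.natDegree - m) * ‖z‖ ^ m := by
    rw [mul_assoc, ← pow_add, Nat.sub_add_cancel hp.le, norm_div, norm_pow,
      div_mul_cancel₀ _ (by positivity)]
  rw [this]
  gcongr

theorem norm_eval_le_of_natDegree_le {p : ℂ[X]} {m : ℕ} (hp : p.natDegree ≤ m) {z : ℂ}
    (hz : 1 ≤ ‖z‖) : ‖p.eval z‖ ≤ (∑ k ∈ Finset.range (m + 1), ‖p.coeff k‖) * ‖z‖ ^ m := by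
  rw [eval_eq_sum_range' (Nat.lt_succ_of_le hp), Finset.sum_mul]
  refine (norm_sum_le _ _).trans (Finset.sum_le_sum fun k hk => ?_)
  rw [norm_mul, norm_pow]
  gcongr
  exact Nat.lt_succ_iff.1 (Finset.mem_range.1 hk)

/-- If along the ray in direction `θ` the leading term of `g i` dominates those of `g j` for all
`j ∈ B`, then eventually `|exp (g i)|²` exceeds the sum of the `|exp (g j)|²`. -/
theorem eventually_sum_exp_le {ι : Type*} (g : ι → ℂ[X]) {k : ℕ} (hk : k ≠ 0)
    (hg : ∀ i, (g i).natDegree ≤ k) (i : ι) (B : Finset ι) (θ : ℝ)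
    (h : ∀ j ∈ B, ((g j).coeff k * Complex.exp (θ * Complex.I) ^ k).re <
      ((g i).coeff k * Complex.exp (θ * Complex.I) ^ k).re) :
    ∀ᶠ r : ℝ in atTop, ∑ j ∈ B, Real.exp (2 * ((g j).eval (circleMap 0 r θ)).re) ≤
      Real.exp (2 * ((g i).eval (circleMap 0 r θ)).re) := by
  set u := Complex.exp (θ * Complex.I) with hu
  have hcm (r : ℝ) : circleMap 0 r θ = r * u := by simp [circleMap, hu]
  have hray : Tendsto (fun r : ℝ => circleMap 0 r θ) atTop (cobounded ℂ) := by
    rw [← tendsto_norm_atTop_iff_cobounded]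
    simpa using tendsto_abs_atTop_atTop
  -- A margin of `log |B|` makes each of the `|B|` terms at most a `1/|B|` share of the dominating
  -- one.
  have hdiff (j : ι) (hj : j ∈ B) : ∀ᶠ r : ℝ in atTop,
      Real.log B.card ≤ 2 * ((g i).eval (circleMap 0 r θ)).re -
        2 * ((g j).eval (circleMap 0 r θ)).re := by
    have hlim (l : ι) : Tendsto (fun r : ℝ => ((g l).eval (circleMap 0 r θ) /
        circleMap 0 r θ ^ k * u ^ k).re) atTop (𝓝 (((g l).coeff k * u ^ k).re)) :=
      (Complex.continuous_re.tendsto _).comp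
        (((tendsto_eval_div_pow (hg l)).comp hray).mul_const _)
    have h₁ := (hlim i).sub (hlim j)
    have h₂ := h₁.pos_mul_atTop (sub_pos.2 (h j hj)) (tendsto_pow_atTop (α := ℝ) hk)
    filter_upwards [h₂.eventually_ge_atTop (Real.log B.card / 2), eventually_gt_atTop 0]
      with r hr hr0
    have hre (l : ι) : ((g l).eval (circleMap 0 r θ) / circleMap 0 r θ ^ k * u ^ k).re * r ^ k =
        ((g l).eval (circleMap 0 r θ)).re := by
      rw [← Complex.re_mul_ofReal]
      congr 1
      have hu0 : u ≠ 0 := by rw [hu]; exact Complex.exp_ne_zero _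
      have hr0' : (r : ℂ) ≠ 0 := by exact_mod_cast hr0.ne'
      rw [hcm, mul_pow]
      push_cast
      field_simp
    rw [sub_mul, hre, hre] at hr
    linarith
  have hall := (Filter.eventually_all_finset B).2 hdiff
  filter_upwards [hall] with r hr
  rcases B.eq_empty_or_nonempty with rfl | hB
  · simp [Real.exp_nonneg]
  have hcard : (0 : ℝ) < B.card := by exact_mod_cast hB.card_pos
  calc ∑ j ∈ B, Real.exp (2 * ((g j).eval (circleMap 0 r θ)).re)
      ≤ ∑ j ∈ B, Real.exp (2 * ((g i).eval (circleMap 0 r θ)).re - Real.log B.card) :=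
        Finset.sum_le_sum fun j hj => Real.exp_le_exp.2 (by linarith [hr j hj])
    _ = Real.exp (2 * ((g i).eval (circleMap 0 r θ)).re) := by
        rw [Finset.sum_const, Real.exp_sub, Real.exp_log hcard, nsmul_eq_mul]
        field_simp

theorem exists_exp_pow_eq {k : ℕ} (hk : k ≠ 0) (t : ℝ) :
    ∃ θ : ℝ, Complex.exp (θ * Complex.I) ^ k = Complex.exp (t * Complex.I) := by
  refine ⟨t / k, ?_⟩
  rw [← Complex.exp_nat_mul]
  congr 1
  push_cast
  field_simp

/-- If some degree exceeded `m + 1`, two classes of exponents with derivatives far apart would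
balance at a point of every large circle, and the variance there would be too large. The zero
exponent is what outweighs the class `A` in the direction where its leading term is negative. -/
theorem natDegree_le_of_gram_le {ι : Type*} [Fintype ι] (g : ι → ℂ[X]) (i₀ : ι) (h₀ : g i₀ = 0)
    {m : ℕ} {C : ℝ} (hC : ∀ z : ℂ, 1 ≤ ‖z‖ →
      gram (fun i => Real.exp (2 * ((g i).eval z).re)) (fun i => (g i).derivative.eval z) ≤
        (C * ‖z‖ ^ m) ^ 2 * (∑ i, Real.exp (2 * ((g i).eval z).re)) ^ 2) (i : ι) :
    (g i).natDegree ≤ m + 1 := by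
  classical
  by_contra! hi
  set k := Finset.univ.sup fun i => (g i).natDegree with hkdef
  have hg (i : ι) : (g i).natDegree ≤ k :=
    Finset.le_sup (f := fun i => (g i).natDegree) (Finset.mem_univ i)
  have hk : m + 1 < k := hi.trans_le (hg i)
  obtain ⟨i₁, -, hi₁⟩ := Finset.exists_max_image Finset.univ (fun i => ‖(g i).coeff k‖)
    ⟨i₀, Finset.mem_univ _⟩
  have ha : (g i₁).coeff k ≠ 0 := by
    obtain ⟨i₂, -, hi₂⟩ := Finset.exists_mem_eq_sup Finset.univ ⟨i₀, Finset.mem_univ _⟩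
      fun i => (g i).natDegree
    rw [← hkdef] at hi₂
    have h₂ : (g i₂).coeff k ≠ 0 := by
      rw [hi₂, coeff_natDegree, leadingCoeff_ne_zero]
      intro h
      rw [h] at hi₂
      simp at hi₂
      omega
    have := hi₁ i₂ (Finset.mem_univ _)
    exact norm_pos_iff.1 ((norm_pos_iff.2 h₂).trans_le this)
  set a := (g i₁).coeff k with hadef
  set A : Finset ι := Finset.univ.filter fun i => (g i).coeff k = a with hA
  have hk0 : k ≠ 0 := by omega
  have hpolar : a = ‖a‖ * Complex.exp (a.arg * Complex.I) := (Complex.norm_mul_exp_arg_mul_I a).symm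
  -- In direction `θ₁` the term `a z^k` is real and positive, in direction `θ₂` real and negative.
  obtain ⟨θ₁, hθ₁⟩ := exists_exp_pow_eq hk0 (-a.arg)
  obtain ⟨θ₂, hθ₂⟩ := exists_exp_pow_eq hk0 (Real.pi - a.arg)
  have hrot₁ : a * Complex.exp (((-a.arg : ℝ) : ℂ) * Complex.I) = ‖a‖ := by
    nth_rw 1 [hpolar]
    rw [mul_assoc, ← Complex.exp_add]
    simp
  have hrot₂ : a * Complex.exp (((Real.pi - a.arg : ℝ) : ℂ) * Complex.I) = -‖a‖ := by
    nth_rw 1 [hpolar]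
    rw [mul_assoc, ← Complex.exp_add]
    push_cast
    rw [show (a.arg : ℂ) * Complex.I + (Real.pi - a.arg) * Complex.I = Real.pi * Complex.I by ring,
      Complex.exp_pi_mul_I]
    simp
  have h₁ := eventually_sum_exp_le g hk0 hg i₁ Aᶜ θ₁ (by
    intro j hj
    rw [hθ₁, ← hadef, hrot₁, Complex.ofReal_re]
    set b := (g j).coeff k * Complex.exp (((-a.arg : ℝ) : ℂ) * Complex.I) with hb
    have hbn : ‖b‖ ≤ ‖a‖ := by
      rw [hb, norm_mul, Complex.norm_exp_ofReal_mul_I, mul_one]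
      exact hi₁ j (Finset.mem_univ _)
    -- Equality would force `b = ‖a‖`, hence the coefficient `a` itself, contradicting `j ∉ A`. This
    -- is where the maximality of `‖a‖` enters.
    refine lt_of_le_of_ne ((Complex.re_le_norm b).trans hbn) fun hre => ?_
    have hba : b = ‖a‖ := by
      have h3 : b.re = ‖b‖ := le_antisymm (Complex.re_le_norm b) (hre ▸ hbn)
      have h4 : b.im = 0 := Complex.abs_re_eq_norm.1 (by rw [h3, abs_norm])
      apply Complex.ext
      · simpa using hre
      · simpa using h4
    rw [← hrot₁, hb] at hba
    have := mul_right_cancel₀ (Complex.exp_ne_zero _) hba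
    simp [hA, this] at hj)
  have h₂ := eventually_sum_exp_le g hk0 hg i₀ A θ₂ (by
    intro j hj
    have hj' : (g j).coeff k = a := by simpa [hA] using hj
    rw [hθ₂, hj', hrot₂, h₀]
    simpa using ha)
  -- At balanced masses the hypothesis allows a separation of at most `2|C| ‖z‖^m`; the extra 1
  -- makes the contradiction strict. The derivative of `g i - g j` has degree `k - 1 > m`.
  have hpairs : ∀ᶠ z in cobounded ℂ, ∀ i ∈ A, ∀ j ∈ Aᶜ,
      (2 * |C| + 1) * ‖z‖ ^ m < ‖(g i - g j).derivative.eval z‖ := by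
    refine (Filter.eventually_all_finset A).2 fun i hi =>
      (Filter.eventually_all_finset Aᶜ).2 fun j hj => eventually_mul_pow_lt_norm_eval ?_ _
    have hi' : (g i).coeff k = a := by simpa [hA] using hi
    have hj' : (g j).coeff k ≠ a := by simpa [hA] using hj
    have hle : k ≤ (g i - g j).natDegree := by
      apply le_natDegree_of_ne_zero
      rw [coeff_sub, hi', sub_ne_zero]
      exact hj'.symm
    rw [natDegree_derivative]
    omega
  obtain ⟨R, hR⟩ := (hasBasis_cobounded_norm (E := ℂ)).eventually_iff.1 hpairs |>.imp fun R h => h.2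
  obtain ⟨r, hr₁, hr₂, hrR, hr1⟩ := (h₁.and (h₂.and ((eventually_ge_atTop R).and
    (eventually_ge_atTop 1)))).exists
  set W : Finset ι → ℝ → ℝ := fun B θ =>
    ∑ j ∈ B, Real.exp (2 * ((g j).eval (circleMap 0 r θ)).re) with hW
  have hWc (B : Finset ι) : Continuous (W B) := by
    refine continuous_finsetSum _ fun j _ => ?_
    have : Continuous fun θ => (g j).eval (circleMap 0 r θ) :=
      (g j).continuous.comp (continuous_circleMap 0 r)
    fun_prop
  have hi₁A : i₁ ∈ A := by simp [hA, hadef]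
  have hi₀A : i₀ ∈ Aᶜ := by simpa [hA, h₀] using ha.symm
  have hle₁ : W Aᶜ θ₁ ≤ W A θ₁ := hr₁.trans
    (Finset.single_le_sum (f := fun j => Real.exp (2 * ((g j).eval (circleMap 0 r θ₁)).re))
      (fun j _ => Real.exp_nonneg _) hi₁A)
  have hle₂ : W A θ₂ ≤ W Aᶜ θ₂ := hr₂.trans
    (Finset.single_le_sum (f := fun j => Real.exp (2 * ((g j).eval (circleMap 0 r θ₂)).re))
      (fun j _ => Real.exp_nonneg _) hi₀A)
  -- The balanced point: both classes carry half of the total weight.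
  obtain ⟨θ, hθ⟩ := intermediate_value_univ₂ (hWc A) (hWc Aᶜ) hle₂ hle₁
  set z := circleMap 0 r θ with hz
  have hzr : ‖z‖ = r := by
    rw [hz, norm_circleMap_zero, abs_of_pos (by linarith)]
  have hsep := hR (show z ∈ _ by simpa [hzr] using hrR)
  have hlow := mass_mul_mass_mul_le_gram
    (e := fun i => Real.exp (2 * ((g i).eval z).re)) (fun i => (Real.exp_pos _).le)
    (fun i => (g i).derivative.eval z) A (c := ((2 * |C| + 1) * ‖z‖ ^ m) ^ 2) (by
      intro i hi j hj
      have := hsep i hi j (by simpa using hj)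
      rw [derivative_sub, eval_sub] at this
      exact pow_le_pow_left₀ (by positivity) this.le 2)
  have hup := hlow.trans (hC z (by rw [hzr]; exact hr1))
  have hsum : ∑ i, Real.exp (2 * ((g i).eval z).re) = W A θ + W Aᶜ θ :=
    (Finset.sum_add_sum_compl A _).symm
  rw [hsum, ← hθ] at hup
  change W A θ * W Aᶜ θ * _ ≤ _ at hup
  rw [← hθ] at hup
  have hWpos : 0 < W A θ := Finset.sum_pos (fun j _ => Real.exp_pos _) ⟨i₁, hi₁A⟩
  have hzpos : 0 < ‖z‖ ^ m := pow_pos (by rw [hzr]; linarith) m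
  have hpos : 0 < (W A θ * ‖z‖ ^ m) ^ 2 := pow_pos (mul_pos hWpos hzpos) 2
  have hfin : (W A θ * ‖z‖ ^ m) ^ 2 * (4 * |C| + 1) ≤ 0 := by
    have : C ^ 2 = |C| ^ 2 := (sq_abs C).symm
    rw [mul_pow C, this] at hup
    nlinarith
  nlinarith [abs_nonneg C]

end Polynomials

end TorusCurve

namespace TorusCurve

open MeasureTheory

/-! ### Green's formula for the logarithm of the total weight -/

section Green

variable {ι : Type*}

/-- The weight `|exp (G i)|²`. -/
noncomputable def weight (G : ι → ℂ → ℂ) (z : ℂ) (i : ι) : ℝ := Real.exp (2 * (G i z).re)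

theorem weight_pos (G : ι → ℂ → ℂ) (z : ℂ) (i : ι) : 0 < weight G z i := Real.exp_pos _

variable {G : ι → ℂ → ℂ}

theorem hasDerivAt_line {g : ℂ → ℂ} (hg : Differentiable ℂ g) (z v : ℂ) :
    HasDerivAt (fun t : ℝ => g (z + t • v)) (deriv g z * v) 0 := by
  have h₁ : HasDerivAt (fun t : ℝ => z + t • v) v 0 := by
    simpa using ((hasDerivAt_id (0 : ℝ)).smul_const v).const_add z
  have h₂ : HasDerivAt g (deriv g z) (z + (0 : ℝ) • v) := by
    simpa using (hg z).hasDerivAt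
  simpa [mul_comm] using! h₂.scomp (0 : ℝ) h₁

theorem hasDerivAt_re {f : ℝ → ℂ} {f' : ℂ} {t : ℝ} (h : HasDerivAt f f' t) :
    HasDerivAt (fun t => (f t).re) f'.re t :=
  Complex.reCLM.hasFDerivAt.comp_hasDerivAt t h

theorem hasDerivAt_weight_line (hG : ∀ i, Differentiable ℂ (G i)) (z v : ℂ) (i : ι) :
    HasDerivAt (fun t : ℝ => (weight G (z + t • v) i : ℂ))
      (weight G z i * (2 * (deriv (G i) z * v).re : ℝ)) 0 := by
  have h₁ : HasDerivAt (fun t : ℝ => (G i (z + t • v)).re) (deriv (G i) z * v).re 0 :=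
    hasDerivAt_re (hasDerivAt_line (hG i) z v)
  have h₂ := ((h₁.const_mul 2).exp).ofReal_comp
  simpa [weight] using h₂

theorem differentiable_weight (hG : ∀ i, Differentiable ℂ (G i)) (i : ι) :
    Differentiable ℝ (fun z => (weight G z i : ℂ)) := by
  have h₁ : Differentiable ℝ (fun z => (G i z).re) :=
    Complex.reCLM.differentiable.comp ((hG i).restrictScalars ℝ)
  exact Complex.ofRealCLM.differentiable.comp (h₁.const_mul 2).exp

theorem continuous_weight (hG : ∀ i, Differentiable ℂ (G i)) (i : ι) :
    Continuous (fun z => weight G z i) := by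
  have := (hG i).continuous
  unfold weight
  fun_prop

theorem differentiable_deriv {g : ℂ → ℂ} (hg : Differentiable ℂ g) : Differentiable ℂ (deriv g) :=
  fun z => (hg.analyticAt z).deriv.differentiableAt

variable [Fintype ι]

theorem sum_weight_pos [Nonempty ι] (G : ι → ℂ → ℂ) (z : ℂ) : 0 < ∑ i, weight G z i :=
  Finset.sum_pos (fun i _ => weight_pos G z i) Finset.univ_nonempty

/-- The variance of the derivatives of the `G i` with respect to the weights `|exp (G i)|²`. -/
noncomputable def spread (G : ι → ℂ → ℂ) (z : ℂ) : ℝ :=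
  gram (weight G z) (fun i => deriv (G i) z) / (∑ i, weight G z i) ^ 2

/-- The mean of the derivatives of the `G i` with respect to the weights `|exp (G i)|²`. -/
noncomputable def meanSlope (G : ι → ℂ → ℂ) (z : ℂ) : ℂ :=
  (∑ i, (weight G z i : ℂ) * deriv (G i) z) / ∑ i, (weight G z i : ℂ)

theorem sum_weight_ne_zero [Nonempty ι] (G : ι → ℂ → ℂ) (z : ℂ) :
    ∑ i, (weight G z i : ℂ) ≠ 0 := by
  rw [← Complex.ofReal_sum]
  exact_mod_cast (sum_weight_pos G z).ne'

theorem spread_nonneg (G : ι → ℂ → ℂ) (z : ℂ) : 0 ≤ spread G z :=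
  div_nonneg (gram_nonneg (fun i => (weight_pos G z i).le) _) (sq_nonneg _)

theorem differentiable_meanSlope [Nonempty ι] (hG : ∀ i, Differentiable ℂ (G i)) :
    Differentiable ℝ (meanSlope G) := by
  unfold meanSlope
  simp only [div_eq_mul_inv]
  refine Differentiable.fun_mul ?_ (Differentiable.fun_inv ?_ fun z => sum_weight_ne_zero G z)
  · exact Differentiable.fun_sum fun i _ => (differentiable_weight hG i).fun_mul
      ((differentiable_deriv (hG i)).restrictScalars ℝ)
  · exact Differentiable.fun_sum fun i _ => differentiable_weight hG i

theorem continuous_spread [Nonempty ι] (hG : ∀ i, Differentiable ℂ (G i)) :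
    Continuous (spread G) := by
  have h₁ := continuous_weight hG
  have h₂ (i : ι) := (differentiable_deriv (hG i)).continuous
  unfold spread gram
  refine Continuous.div (by fun_prop) (by fun_prop) fun z => ?_
  exact pow_ne_zero 2 (sum_weight_pos G z).ne'

theorem fderiv_meanSlope_apply [Nonempty ι] (hG : ∀ i, Differentiable ℂ (G i)) (z v : ℂ) :
    fderiv ℝ (meanSlope G) z v =
      ((∑ i, (weight G z i * (2 * (deriv (G i) z * v).re : ℝ) * deriv (G i) z +
          weight G z i * (deriv (deriv (G i)) z * v))) * (∑ i, (weight G z i : ℂ)) -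
        (∑ i, (weight G z i : ℂ) * deriv (G i) z) *
          ∑ i, (weight G z i : ℂ) * (2 * (deriv (G i) z * v).re : ℝ)) /
        (∑ i, (weight G z i : ℂ)) ^ 2 := by
  have h₁ := ((differentiable_meanSlope hG z).hasFDerivAt).hasLineDerivAt v
  refine h₁.unique ?_
  have hN : HasDerivAt (fun t : ℝ => ∑ i, (weight G (z + t • v) i : ℂ) * deriv (G i) (z + t • v))
      (∑ i, (weight G z i * (2 * (deriv (G i) z * v).re : ℝ) * deriv (G i) z +
          weight G z i * (deriv (deriv (G i)) z * v))) 0 := by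
    refine HasDerivAt.fun_sum fun i _ => ?_
    simpa using! (hasDerivAt_weight_line hG z v i).fun_mul
      (hasDerivAt_line (differentiable_deriv (hG i)) z v)
  have hD : HasDerivAt (fun t : ℝ => ∑ i, (weight G (z + t • v) i : ℂ))
      (∑ i, (weight G z i : ℂ) * (2 * (deriv (G i) z * v).re : ℝ)) 0 :=
    HasDerivAt.fun_sum fun i _ => hasDerivAt_weight_line hG z v i
  have := hN.fun_div hD (sum_weight_ne_zero G _)
  simpa [HasLineDerivAt, meanSlope] using! this

/-- The left side is `2i ∂̄` of the mean slope. The slopes are holomorphic, so `∂̄` acts on the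
weights only, where it multiplies by the conjugate slope; the quotient rule then yields the
variance. -/
theorem dbar_meanSlope [Nonempty ι] (hG : ∀ i, Differentiable ℂ (G i)) (z : ℂ) :
    Complex.I • fderiv ℝ (meanSlope G) z 1 - fderiv ℝ (meanSlope G) z Complex.I =
      2 * Complex.I * (spread G z : ℂ) := by
  have hre (d : ℂ) : Complex.I * ((2 * (d * 1).re : ℝ) : ℂ) - ((2 * (d * Complex.I).re : ℝ) : ℂ) =
      2 * Complex.I * (starRingEnd ℂ) d := by
    apply Complex.ext <;> simp
  rw [fderiv_meanSlope_apply hG, fderiv_meanSlope_apply hG, smul_eq_mul, spread, gram]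
  push_cast
  rw [← Complex.mul_conj', map_sum, mul_div_assoc', ← sub_div, mul_div_assoc']
  congr 1
  set N := ∑ i, (weight G z i : ℂ) * deriv (G i) z
  set D := ∑ i, (weight G z i : ℂ)
  have h₁ : Complex.I * (∑ i, (weight G z i * (2 * (deriv (G i) z * 1).re : ℝ) * deriv (G i) z +
          weight G z i * (deriv (deriv (G i)) z * 1))) -
      (∑ i, (weight G z i * (2 * (deriv (G i) z * Complex.I).re : ℝ) * deriv (G i) z +
          weight G z i * (deriv (deriv (G i)) z * Complex.I))) =
      2 * Complex.I * ∑ i, (weight G z i : ℂ) * (‖deriv (G i) z‖ : ℂ) ^ 2 := by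
    rw [Finset.mul_sum, Finset.mul_sum, ← Finset.sum_sub_distrib]
    refine Finset.sum_congr rfl fun i _ => ?_
    rw [← Complex.mul_conj']
    linear_combination (weight G z i : ℂ) * deriv (G i) z * hre (deriv (G i) z)
  have h₂ : Complex.I * (∑ i, (weight G z i : ℂ) * (2 * (deriv (G i) z * 1).re : ℝ)) -
      (∑ i, (weight G z i : ℂ) * (2 * (deriv (G i) z * Complex.I).re : ℝ)) =
      2 * Complex.I * ∑ i, (starRingEnd ℂ) ((weight G z i : ℂ) * deriv (G i) z) := by
    rw [Finset.mul_sum, Finset.mul_sum, ← Finset.sum_sub_distrib]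
    refine Finset.sum_congr rfl fun i _ => ?_
    rw [map_mul, Complex.conj_ofReal]
    linear_combination (weight G z i : ℂ) * hre (deriv (G i) z)
  push_cast at h₁ h₂
  linear_combination D * h₁ - N * h₂

/-- The mean slope is `∂` of the logarithm of the total weight, and `∂/∂x = 2 Re ∂` on real
functions. -/
theorem hasDerivAt_log_sum_weight [Nonempty ι] (hG : ∀ i, Differentiable ℂ (G i)) (s y : ℝ) :
    HasDerivAt (fun s : ℝ => Real.log (∑ i, weight G (s + y * Complex.I) i))
      (2 * (meanSlope G (s + y * Complex.I)).re) s := by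
  set z : ℂ := s + y * Complex.I
  have hw (i : ι) : HasDerivAt (fun s : ℝ => weight G (s + y * Complex.I) i)
      (weight G z i * (2 * (deriv (G i) z).re)) s := by
    have h₁ : HasDerivAt (fun s : ℝ => G i (s + y * Complex.I)) (deriv (G i) z) s := by
      have h₂ : HasDerivAt (fun s : ℝ => (s : ℂ) + y * Complex.I) 1 s :=
        (Complex.ofRealCLM.hasDerivAt).add_const _
      simpa using! ((hG i z).hasDerivAt).scomp s h₂
    exact ((hasDerivAt_re h₁).const_mul 2).exp
  have h := (HasDerivAt.fun_sum fun i (_ : i ∈ Finset.univ) => hw i).log (sum_weight_pos G z).ne'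
  convert! h using 1
  rw [meanSlope, ← Complex.ofReal_sum, Complex.div_ofReal_re, Complex.re_sum, mul_div_assoc',
    Finset.mul_sum]
  congr 1
  refine Finset.sum_congr rfl fun i _ => ?_
  rw [Complex.re_ofReal_mul]
  ring

theorem integral_meanSlope_vertical [Nonempty ι] (hG : ∀ i, Differentiable ℂ (G i)) {T : ℝ}
    (hT : ∀ i z, G i (z + T * Complex.I) = G i z) (x : ℝ) :
    ∫ y in (0 : ℝ)..T, meanSlope G (x + y * Complex.I) =
      (∫ y in (0 : ℝ)..T, meanSlope G (y * Complex.I)) +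
        ∫ s in (0 : ℝ)..x, ∫ y in (0 : ℝ)..T, (2 * spread G (s + y * Complex.I) : ℂ) := by
  have hper (z : ℂ) : meanSlope G (z + T * Complex.I) = meanSlope G z := by
    have hd (i : ι) : deriv (G i) (z + T * Complex.I) = deriv (G i) z := by
      rw [← deriv_comp_add_const]
      congr 1
      exact funext (hT i)
    simp only [meanSlope, weight, hT, hd]
  have h := Complex.integral_boundary_rect_of_differentiableOn_real (meanSlope G) 0
    (x + T * Complex.I) (differentiable_meanSlope hG).differentiableOn (by
      simp only [dbar_meanSlope hG]
      refine ContinuousOn.integrableOn_compact (isCompact_uIcc.reProdIm isCompact_uIcc) ?_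
      have := continuous_spread hG
      fun_prop)
  simp only [dbar_meanSlope hG] at h
  -- By periodicity the two horizontal sides of the rectangle cancel.
  simp only [Complex.zero_re, Complex.zero_im, Complex.add_re, Complex.add_im, Complex.ofReal_re,
    Complex.ofReal_im, Complex.mul_re, Complex.mul_im, Complex.I_re, Complex.I_im, mul_zero,
    mul_one, add_zero, zero_add, Complex.ofReal_zero, zero_mul, hper, sub_self,
    smul_eq_mul] at h
  have h₂ : ∫ s in (0 : ℝ)..x, ∫ y in (0 : ℝ)..T, 2 * Complex.I * (spread G (s + y * Complex.I) : ℂ)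
      = Complex.I * ∫ s in (0 : ℝ)..x, ∫ y in (0 : ℝ)..T, (2 * spread G (s + y * Complex.I) : ℂ) := by
    simp only [← intervalIntegral.integral_const_mul]
    simp only [← mul_assoc, mul_comm Complex.I 2]
  rw [h₂, ← mul_sub] at h
  have := mul_left_cancel₀ Complex.I_ne_zero h
  linear_combination this

theorem integral_log_sum_weight [Nonempty ι] (hG : ∀ i, Differentiable ℂ (G i)) (T x : ℝ) :
    ∫ y in (0 : ℝ)..T, Real.log (∑ i, weight G (x + y * Complex.I) i) =
      (∫ y in (0 : ℝ)..T, Real.log (∑ i, weight G (y * Complex.I) i)) +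
        ∫ s in (0 : ℝ)..x, 2 * (∫ y in (0 : ℝ)..T, meanSlope G (s + y * Complex.I)).re := by
  have hP := (differentiable_meanSlope hG).continuous
  have hW : Continuous fun z => Real.log (∑ i, weight G z i) := by
    have := continuous_weight hG
    exact Continuous.log (by fun_prop) fun z => (sum_weight_pos G z).ne'
  have hre (s : ℝ) : 2 * (∫ y in (0 : ℝ)..T, meanSlope G (s + y * Complex.I)).re =
      ∫ y in (0 : ℝ)..T, 2 * (meanSlope G (s + y * Complex.I)).re := by
    rw [intervalIntegral.integral_const_mul]
    congr 1
    exact (Complex.reCLM.intervalIntegral_comp_comm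
      (Continuous.intervalIntegrable (by fun_prop) _ _)).symm
  simp only [hre]
  -- After Fubini, the inner integral is evaluated along each horizontal line by the fundamental
  -- theorem of calculus.
  rw [intervalIntegral_intervalIntegral_swap]
  · rw [← intervalIntegral.integral_add]
    · refine intervalIntegral.integral_congr fun y _ => ?_
      have := intervalIntegral.integral_eq_sub_of_hasDerivAt
        (fun s _ => hasDerivAt_log_sum_weight hG s y)
        (Continuous.intervalIntegrable (by fun_prop) 0 x)
      simp only [this]
      simp
    · exact (hW.comp (f := fun y : ℝ => y * Complex.I) (by fun_prop)).intervalIntegrable _ _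
    · exact (intervalIntegral.continuous_parametric_intervalIntegral_of_continuous'
        (by fun_prop) _ _).intervalIntegrable _ _
  · refine IntegrableOn.mono_set (t := Set.uIcc 0 x ×ˢ Set.uIcc 0 T) ?_
      (Set.prod_mono Set.uIoc_subset_uIcc Set.uIoc_subset_uIcc)
    refine ContinuousOn.integrableOn_compact (isCompact_uIcc.prod isCompact_uIcc) ?_
    exact Continuous.continuousOn (by unfold Function.uncurry; fun_prop)

/-- If the spread of periodic functions grows at most exponentially, then so do the means of the
logarithm of the total weight. -/
theorem exists_integral_log_sum_weight_le [Nonempty ι] (hG : ∀ i, Differentiable ℂ (G i)) {T : ℝ}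
    (hT0 : 0 ≤ T) (hT : ∀ i z, G i (z + T * Complex.I) = G i z) {C q : ℝ} (hq : 0 ≤ q)
    (hC : ∀ z : ℂ, 0 ≤ z.re → spread G z ≤ C * Real.exp (q * z.re)) :
    ∃ A : ℝ, ∀ x : ℝ, 0 ≤ x →
      ∫ y in (0 : ℝ)..T, Real.log (∑ i, weight G (x + y * Complex.I) i) ≤
        A * Real.exp ((q + 2) * x) := by
  have hC0 : 0 ≤ C := by simpa using (spread_nonneg G 0).trans (hC 0 le_rfl)
  set c₀ := ∫ y in (0 : ℝ)..T, meanSlope G (y * Complex.I) with hc₀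
  set c₁ := ∫ y in (0 : ℝ)..T, Real.log (∑ i, weight G (y * Complex.I) i) with hc₁
  refine ⟨|c₁| + 2 * (‖c₀‖ + 2 * C * T), fun x hx => ?_⟩
  set E := Real.exp (q * x) with hE
  have hE1 : 1 ≤ E := Real.one_le_exp (by positivity)
  have hslope (s : ℝ) (hs0 : 0 ≤ s) (hsx : s ≤ x) :
      ‖∫ y in (0 : ℝ)..T, meanSlope G (s + y * Complex.I)‖ ≤ ‖c₀‖ + 2 * C * E * T * x := by
    rw [integral_meanSlope_vertical hG hT]
    refine (norm_add_le _ _).trans (add_le_add le_rfl ?_)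
    have hin (t : ℝ) (ht : t ∈ Set.uIoc 0 s) :
        ‖∫ y in (0 : ℝ)..T, (2 * spread G (t + y * Complex.I) : ℂ)‖ ≤ 2 * C * E * T := by
      rw [Set.uIoc_of_le hs0] at ht
      have := intervalIntegral.norm_integral_le_of_norm_le_const (a := (0 : ℝ)) (b := T)
        (f := fun y : ℝ => (2 * spread G (t + y * Complex.I) : ℂ)) (C := 2 * C * E) (by
          intro y _
          rw [norm_mul, Complex.norm_real, Real.norm_of_nonneg (spread_nonneg _ _),
            Complex.norm_two, mul_assoc]
          refine mul_le_mul_of_nonneg_left ?_ two_pos.le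
          refine (hC _ (by simpa using ht.1.le)).trans ?_
          refine mul_le_mul_of_nonneg_left (Real.exp_le_exp.2 ?_) hC0
          refine mul_le_mul_of_nonneg_left ?_ hq
          simpa using ht.2.trans hsx)
      rwa [sub_zero, abs_of_nonneg hT0] at this
    refine (intervalIntegral.norm_integral_le_of_norm_le_const hin).trans ?_
    rw [sub_zero, abs_of_nonneg hs0]
    gcongr
  have hmain : ‖∫ s in (0 : ℝ)..x, 2 * (∫ y in (0 : ℝ)..T, meanSlope G (s + y * Complex.I)).re‖ ≤
      2 * (‖c₀‖ + 2 * C * E * T * x) * |x - 0| := by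
    refine intervalIntegral.norm_integral_le_of_norm_le_const fun s hs => ?_
    rw [Set.uIoc_of_le hx] at hs
    rw [norm_mul, Real.norm_ofNat]
    exact mul_le_mul_of_nonneg_left ((Complex.abs_re_le_norm _).trans (hslope s hs.1.le hs.2))
      two_pos.le
  rw [sub_zero, abs_of_nonneg hx] at hmain
  rw [integral_log_sum_weight hG]
  -- Two integrations in `x` produce factors up to `x²`; the additional `2` in the exponent absorbs
  -- them.
  have hX : x ≤ Real.exp x := by linarith [Real.add_one_le_exp x]
  have hX1 : 1 ≤ Real.exp x := Real.one_le_exp hx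
  have hexp : Real.exp ((q + 2) * x) = E * Real.exp x ^ 2 := by
    rw [hE, ← Real.exp_nat_mul, ← Real.exp_add]
    congr 1
    push_cast
    ring
  rw [hexp]
  set X := Real.exp x
  have hEX : 1 ≤ E * X ^ 2 := one_le_mul_of_one_le_of_one_le hE1 (one_le_pow₀ hX1)
  have hxE : x ≤ E * X ^ 2 := by
    calc x ≤ X := hX
      _ ≤ X ^ 2 := by nlinarith
      _ ≤ E * X ^ 2 := le_mul_of_one_le_left (by positivity) hE1
  have hxxE : E * x ^ 2 ≤ E * X ^ 2 := by gcongr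
  have h1 : c₁ ≤ |c₁| * (E * X ^ 2) :=
    (le_abs_self _).trans (le_mul_of_one_le_right (abs_nonneg _) hEX)
  have h2 : ‖c₀‖ * x ≤ ‖c₀‖ * (E * X ^ 2) := mul_le_mul_of_nonneg_left hxE (norm_nonneg _)
  have h3 : C * T * (E * x ^ 2) ≤ C * T * (E * X ^ 2) :=
    mul_le_mul_of_nonneg_left hxxE (by positivity)
  have h4 := (Real.le_norm_self _).trans hmain
  nlinarith

end Green

/-! ### Entire functions whose real part has positive part of polynomial mean growth -/

section Entire

theorem integral_mul_circleMap_pow {g : ℂ → ℂ} (hg : Differentiable ℂ g) (r : ℝ) {k : ℕ}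
    (hk : k ≠ 0) : ∫ θ in (0 : ℝ)..2 * Real.pi, g (circleMap 0 r θ) * circleMap 0 r θ ^ k = 0 := by
  have h : Differentiable ℂ fun z => g z * z ^ k := by fun_prop
  have h₁ := (h.diffContOnCl (s := Metric.ball 0 |r|)).circleAverage
  rw [Real.circleAverage_def] at h₁
  simp only [zero_pow hk, mul_zero, smul_eq_zero] at h₁
  exact h₁.resolve_left (by positivity)

theorem integral_div_circleMap_pow {g : ℂ → ℂ} (hg : Differentiable ℂ g) {r : ℝ} (hr : 0 < r)
    (k : ℕ) : ∫ θ in (0 : ℝ)..2 * Real.pi, g (circleMap 0 r θ) / circleMap 0 r θ ^ k =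
      2 * Real.pi / k.factorial * iteratedDeriv k g 0 := by
  have h := (hg.diffContOnCl (s := Metric.ball 0 r)).circleIntegral_one_div_sub_center_pow_smul hr k
  have h₁ (θ : ℝ) : deriv (circleMap 0 r) θ • (1 / (circleMap 0 r θ - 0) ^ (k + 1)) •
      g (circleMap 0 r θ) = Complex.I * (g (circleMap 0 r θ) / circleMap 0 r θ ^ k) := by
    have := circleMap_ne_center (c := 0) (θ := θ) hr.ne'
    rw [deriv_circleMap, sub_zero, smul_eq_mul, smul_eq_mul, pow_succ]
    field_simp
  simp only [circleIntegral, h₁] at h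
  rw [intervalIntegral.integral_const_mul, smul_eq_mul] at h
  apply mul_left_cancel₀ Complex.I_ne_zero
  rw [h]
  ring

theorem integral_conj_div_circleMap_pow {g : ℂ → ℂ} (hg : Differentiable ℂ g) {r : ℝ} (hr : 0 < r)
    {k : ℕ} (hk : k ≠ 0) :
    ∫ θ in (0 : ℝ)..2 * Real.pi, (starRingEnd ℂ) (g (circleMap 0 r θ)) / circleMap 0 r θ ^ k =
      0 := by
  -- On the circle `1/z = z̄/r²`, so the integrand is a multiple of the conjugate of `g(z) z^k`.
  have h₁ (θ : ℝ) : (starRingEnd ℂ) (g (circleMap 0 r θ)) / circleMap 0 r θ ^ k =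
      ((r : ℂ) ^ 2)⁻¹ ^ k * (starRingEnd ℂ) (g (circleMap 0 r θ) * circleMap 0 r θ ^ k) := by
    have h0 := circleMap_ne_center (c := 0) (θ := θ) hr.ne'
    have hr' : (r : ℂ) ≠ 0 := by exact_mod_cast hr.ne'
    have h2 : circleMap 0 r θ * (starRingEnd ℂ) (circleMap 0 r θ) = (r : ℂ) ^ 2 := by
      rw [Complex.mul_conj', norm_circleMap_zero, abs_of_pos hr]
    rw [map_mul, map_pow, ← h2, div_eq_iff (pow_ne_zero k h0)]
    have h3 : (starRingEnd ℂ) (circleMap 0 r θ) ≠ 0 := by simpa using h0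
    rw [mul_inv, mul_pow, inv_pow, inv_pow]
    field_simp
  have hc : Continuous fun θ => g (circleMap 0 r θ) * circleMap 0 r θ ^ k := by
    have := hg.continuous.comp (continuous_circleMap 0 r)
    exact this.mul ((continuous_circleMap 0 r).pow k)
  have h₂ := Complex.conjCLE.toContinuousLinearMap.intervalIntegral_comp_comm
    (hc.intervalIntegrable (μ := volume) 0 (2 * Real.pi))
  rw [integral_mul_circleMap_pow hg r hk, map_zero] at h₂
  simp only [h₁]
  rw [intervalIntegral.integral_const_mul]
  exact mul_eq_zero_of_right _ h₂

/-- The Taylor coefficient is a Fourier coefficient of `2 Re g = g + ḡ`, since `ḡ` contributes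
nothing for `k ≠ 0`. Moreover `|2 Re g| = 4 (Re g)⁺ - 2 Re g`, and the mean of `Re g` is `Re g(0)`.
-/
theorem norm_iteratedDeriv_le_of_integral_re_le {g : ℂ → ℂ} (hg : Differentiable ℂ g) {r : ℝ}
    (hr : 0 < r) {k : ℕ} (hk : k ≠ 0) {M : ℝ}
    (hM : ∫ θ in (0 : ℝ)..2 * Real.pi, max (g (circleMap 0 r θ)).re 0 ≤ M) :
    2 * Real.pi / k.factorial * ‖iteratedDeriv k g 0‖ * r ^ k ≤
      4 * M + 4 * Real.pi * ‖g 0‖ := by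
  have hcm := continuous_circleMap 0 r
  have hgc : Continuous fun θ => g (circleMap 0 r θ) := hg.continuous.comp hcm
  have hne (θ : ℝ) : circleMap 0 r θ ^ k ≠ 0 := pow_ne_zero k (circleMap_ne_center hr.ne')
  have hcoeff : ∫ θ in (0 : ℝ)..2 * Real.pi,
      ((2 * (g (circleMap 0 r θ)).re : ℝ) : ℂ) / circleMap 0 r θ ^ k =
        2 * Real.pi / k.factorial * iteratedDeriv k g 0 := by
    have hsum := intervalIntegral.integral_add (μ := volume) (a := 0) (b := 2 * Real.pi)
      (f := fun θ => g (circleMap 0 r θ) / circleMap 0 r θ ^ k)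
      (g := fun θ => (starRingEnd ℂ) (g (circleMap 0 r θ)) / circleMap 0 r θ ^ k) ?_ ?_
    · rw [integral_div_circleMap_pow hg hr k, integral_conj_div_circleMap_pow hg hr hk,
        add_zero] at hsum
      rw [← hsum]
      refine intervalIntegral.integral_congr fun θ _ => ?_
      simp only [← Complex.add_conj, add_div]
    · exact (hgc.div (hcm.pow k) hne).intervalIntegrable _ _
    · exact ((Complex.continuous_conj.comp hgc).div (hcm.pow k) hne).intervalIntegrable _ _
  have hmean : ∫ θ in (0 : ℝ)..2 * Real.pi, (g (circleMap 0 r θ)).re = 2 * Real.pi * (g 0).re := by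
    have h₁ := (hg.diffContOnCl (s := Metric.ball 0 |r|)).circleAverage
    rw [Real.circleAverage_def, inv_smul_eq_iff₀ (by positivity)] at h₁
    have h₂ := Complex.reCLM.intervalIntegral_comp_comm
      (hgc.intervalIntegrable (μ := volume) 0 (2 * Real.pi))
    rw [h₁] at h₂
    simpa using! h₂
  have hle := intervalIntegral.norm_integral_le_integral_norm (μ := volume)
    (f := fun θ => ((2 * (g (circleMap 0 r θ)).re : ℝ) : ℂ) / circleMap 0 r θ ^ k)
    (a := 0) (b := 2 * Real.pi) (by positivity)
  have hnorm (θ : ℝ) : ‖((2 * (g (circleMap 0 r θ)).re : ℝ) : ℂ) / circleMap 0 r θ ^ k‖ =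
      (4 * max (g (circleMap 0 r θ)).re 0 - 2 * (g (circleMap 0 r θ)).re) * (r ^ k)⁻¹ := by
    rw [norm_div, norm_pow, norm_circleMap_zero, abs_of_pos hr, Complex.norm_real, div_eq_mul_inv,
      Real.norm_eq_abs]
    congr 1
    rcases le_total (g (circleMap 0 r θ)).re 0 with h | h
    · rw [max_eq_right h, abs_of_nonpos (by linarith)]
      ring
    · rw [max_eq_left h, abs_of_nonneg (by linarith)]
      ring
  rw [hcoeff] at hle
  simp only [hnorm] at hle
  have hre : Continuous fun θ => (g (circleMap 0 r θ)).re := Complex.continuous_re.comp hgc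
  rw [intervalIntegral.integral_mul_const, intervalIntegral.integral_sub
    (Continuous.intervalIntegrable (by fun_prop) _ _)
    (Continuous.intervalIntegrable (by fun_prop) _ _), intervalIntegral.integral_const_mul,
    intervalIntegral.integral_const_mul, hmean, ← div_eq_mul_inv, le_div_iff₀ (by positivity)]
    at hle
  have hn : ‖(2 * Real.pi / k.factorial * iteratedDeriv k g 0 : ℂ)‖ =
      2 * Real.pi / k.factorial * ‖iteratedDeriv k g 0‖ := by
    simp [abs_of_pos Real.pi_pos]
  rw [hn] at hle
  have h0 : -(g 0).re ≤ ‖g 0‖ := (neg_le_abs _).trans (Complex.abs_re_le_norm _)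
  have := mul_le_mul_of_nonneg_left h0 Real.pi_pos.le
  linarith

theorem exists_polynomial_of_integral_re_le {g : ℂ → ℂ} (hg : Differentiable ℂ g) {A : ℝ} {K : ℕ}
    (hA : ∀ r : ℝ, 1 ≤ r →
      ∫ θ in (0 : ℝ)..2 * Real.pi, max (g (circleMap 0 r θ)).re 0 ≤ A * r ^ K) :
    ∃ p : Polynomial ℂ, ∀ z, g z = p.eval z := by
  have hzero (k : ℕ) (hk : K < k) : iteratedDeriv k g 0 = 0 := by
    by_contra hne
    set c := 2 * Real.pi / k.factorial * ‖iteratedDeriv k g 0‖ with hc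
    have hcpos : 0 < c := by
      have := norm_pos_iff.2 hne
      have := Real.pi_pos
      positivity
    set B := 4 * |A| + 4 * Real.pi * ‖g 0‖ with hB
    have hB0 : 0 ≤ B := by have := Real.pi_pos; positivity
    -- This radius gives `c * r = B + c > B`, whereas the estimate with `k ≥ K + 1` would require `c
    -- * r ≤ B`.
    set r := B / c + 1 with hr
    have hr1 : 1 ≤ r := by have := div_nonneg hB0 hcpos.le; linarith
    have h := norm_iteratedDeriv_le_of_integral_re_le hg (by linarith) (by omega : k ≠ 0) (hA r hr1)
    rw [← hc] at h
    have h₁ : r ^ K * r ≤ r ^ k := by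
      rw [← pow_succ]
      exact pow_le_pow_right₀ hr1 hk
    have hrK : 1 ≤ r ^ K := one_le_pow₀ hr1
    have hup : c * r ^ k ≤ B * r ^ K := by
      have h2 : A * r ^ K ≤ |A| * r ^ K := by gcongr; exact le_abs_self A
      have h3 : 4 * Real.pi * ‖g 0‖ ≤ 4 * Real.pi * ‖g 0‖ * r ^ K :=
        le_mul_of_one_le_right (by have := Real.pi_pos; positivity) hrK
      rw [hB]
      linarith
    have hcr : c * r = B + c := by
      rw [hr]
      field_simp
    have h4 : c * (r ^ K * r) ≤ c * r ^ k := mul_le_mul_of_nonneg_left h₁ hcpos.le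
    have h5 : 0 < c * r ^ K := by positivity
    nlinarith
  refine ⟨∑ k ∈ Finset.range (K + 1),
    Polynomial.monomial k ((k.factorial : ℂ)⁻¹ * iteratedDeriv k g 0), fun z => ?_⟩
  rw [← Complex.taylorSeries_eq_of_entire' 0 z hg, Polynomial.eval_finsetSum,
    tsum_eq_sum (s := Finset.range (K + 1))]
  · simp
  · intro k hk
    rw [hzero k (by simpa using hk)]
    simp

end Entire

end TorusCurve

namespace TorusCurve

/-! ### Logarithmic coordinates on the torus -/

section Chart

variable {n : ℕ}

theorem affineChart_point (w : Fin n → ℂ) : affineChart 0 (point w) = WithLp.toLp 2 w := by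
  rw [point, affineChart, Projectivization.lift_mk]
  ext j
  simp

theorem point_mem_affineOpen_zero (w : Fin n → ℂ) : point w ∈ affineOpen (0 : Fin (n + 1)) :=
  ⟨Fin.cons 1 w, cons_one_ne_zero w, by simp, rfl⟩

/-- An entire function without zeros has an entire logarithm. -/
theorem exists_entire_log {h : ℂ → ℂ} (hh : Differentiable ℂ h) (h0 : ∀ z, h z ≠ 0) :
    ∃ g : ℂ → ℂ, Differentiable ℂ g ∧ ∀ z, h z = Complex.exp (g z) := by
  have hlog : Differentiable ℂ fun z => deriv h z / h z :=
    (differentiable_deriv hh).fun_div hh h0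
  obtain ⟨g, hg⟩ := hlog.isExactOn_univ.with_val_at 0 (Complex.log (h 0))
  have hgd (z : ℂ) : HasDerivAt g (deriv h z / h z) z := hg.2 z (Set.mem_univ z)
  refine ⟨g, fun z => (hgd z).differentiableAt, fun z => ?_⟩
  have hq (z : ℂ) : HasDerivAt (fun z => h z * Complex.exp (-g z)) 0 z := by
    have hd := (hh z).hasDerivAt.fun_mul (hgd z).fun_neg.cexp
    have hd0 : deriv h z * Complex.exp (-g z) +
        h z * (Complex.exp (-g z) * -(deriv h z / h z)) = 0 := by
      have := h0 z
      field_simp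
      ring
    rwa [hd0] at hd
  have hconst := is_const_of_deriv_eq_zero (fun z => (hq z).differentiableAt)
    (fun z => (hq z).deriv) z 0
  simp only [hg.1, Complex.exp_neg, Complex.exp_log (h0 0)] at hconst
  rw [mul_inv_cancel₀ (h0 0)] at hconst
  exact eq_of_div_eq_one hconst

/-- A holomorphic curve in the torus is given by exponentials of entire functions. -/
theorem IsHolomorphic.exists_eq_point_exp {f : ℂ → CP n} (hf : IsHolomorphic f)
    (hX : ∀ z, f z ∈ torus n) :
    ∃ g : Fin n → ℂ → ℂ, (∀ i, Differentiable ℂ (g i)) ∧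
      ∀ z, f z = point fun i => Complex.exp (g i z) := by
  choose w hw0 hw using hX
  have hpre : f ⁻¹' affineOpen 0 = Set.univ :=
    Set.eq_univ_of_forall fun z => by
      rw [Set.mem_preimage, hw z]
      exact point_mem_affineOpen_zero _
  have hd := (hf 0).2
  rw [hpre, differentiableOn_univ] at hd
  simp only [hw, affineChart_point] at hd
  have hwd (i : Fin n) : Differentiable ℂ fun z => w z i :=
    (differentiable_euclidean.1 hd) i
  choose g hgd hg using fun i => exists_entire_log (hwd i) fun z => hw0 z i
  refine ⟨g, hgd, fun z => ?_⟩
  rw [hw z]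
  congr 1
  exact funext fun i => hg i z

/-- The exponents of a curve in the torus, with the exponent `0` of the first coordinate. -/
noncomputable def exponents (g : Fin n → ℂ → ℂ) : Fin (n + 1) → ℂ → ℂ := Fin.cons (fun _ => 0) g

/-- In the chart the velocity has components `e^{g_i} g_i'`. The zero exponent has weight 1 and
slope 0, which accounts for the `1 + ‖u‖²` of the metric; the factor `√2` cancels the `1/2` in its
normalization. -/
theorem normDiff_eq {f : ℂ → CP n} {g : Fin n → ℂ → ℂ} (hg : ∀ i, Differentiable ℂ (g i))
    (hf : ∀ z, f z = point fun i => Complex.exp (g i z)) (z : ℂ) :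
    normDiff f z = √(spread (exponents g) z / Real.pi) := by
  have hchart (ζ : ℂ) : affineChart 0 (f ζ) = WithLp.toLp 2 fun i => Complex.exp (g i ζ) := by
    rw [hf, affineChart_point]
  have hderiv : deriv (fun ζ => affineChart 0 (f ζ)) z =
      WithLp.toLp 2 fun i => Complex.exp (g i z) * deriv (g i) z := by
    simp only [hchart]
    refine HasDerivAt.deriv ?_
    exact (PiLp.hasFDerivAt_toLp 2 _).comp_hasDerivAt z
      (hasDerivAt_pi.2 fun i => (hg i z).hasDerivAt.cexp)
  have hnorm (i : Fin n) : ‖Complex.exp (g i z)‖ ^ 2 = weight g z i := by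
    rw [Complex.norm_exp, weight, ← Real.exp_nat_mul]
    norm_num
  simp only [normDiff, hderiv]
  rw [hchart]
  rw [← Real.sqrt_mul two_pos.le]
  congr 1
  set u : EuclideanSpace ℂ (Fin n) := WithLp.toLp 2 fun i => Complex.exp (g i z) with hu
  set v : EuclideanSpace ℂ (Fin n) :=
    WithLp.toLp 2 fun i => Complex.exp (g i z) * deriv (g i) z with hv
  have hun : ‖u‖ ^ 2 = ∑ i, weight g z i := by
    rw [EuclideanSpace.norm_sq_eq]
    exact Finset.sum_congr rfl fun i _ => hnorm i
  have hvn : ‖v‖ ^ 2 = ∑ i, weight g z i * ‖deriv (g i) z‖ ^ 2 := by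
    rw [EuclideanSpace.norm_sq_eq]
    refine Finset.sum_congr rfl fun i _ => ?_
    rw [← hnorm, ← mul_pow, ← norm_mul]
  have huv : inner ℂ u v = ∑ i, (weight g z i : ℂ) * deriv (g i) z := by
    rw [PiLp.inner_apply]
    refine Finset.sum_congr rfl fun i _ => ?_
    rw [← hnorm, Complex.ofReal_pow, ← Complex.mul_conj']
    simp only [hu, hv, RCLike.inner_apply]
    ring
  have hfs : fubiniStudy u v v = ((1 / (2 * Real.pi) *
      (((1 + ‖u‖ ^ 2) * ‖v‖ ^ 2 - ‖inner ℂ u v‖ ^ 2) / (1 + ‖u‖ ^ 2) ^ 2) : ℝ) : ℂ) := by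
    rw [fubiniStudy, inner_self_eq_norm_sq_to_K, ← inner_conj_symm v u, mul_comm (starRingEnd ℂ _),
      Complex.mul_conj']
    push_cast
    rfl
  rw [hfs, Complex.ofReal_re, hun, hvn, huv, spread, gram]
  simp only [exponents, Fin.sum_univ_succ, weight, Fin.cons_zero, Fin.cons_succ]
  simp
  field_simp

theorem exponents_eval (p : Fin n → Polynomial ℂ) :
    exponents (fun i z => (p i).eval z) =
      fun i z => (Fin.cons 0 p : Fin (n + 1) → Polynomial ℂ) i |>.eval z := by
  funext i z
  refine Fin.cases ?_ (fun j => ?_) i <;> simp [exponents]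

end Chart

/-! ### From variance growth to polynomial exponents -/

section Growth

variable {ι : Type*} [Fintype ι]

theorem spread_comp_exp {g : ι → ℂ → ℂ} (hg : ∀ i, Differentiable ℂ (g i)) (w : ℂ) :
    spread (fun i w => g i (Complex.exp w)) w =
      ‖Complex.exp w‖ ^ 2 * spread g (Complex.exp w) := by
  have hd (i : ι) : deriv (fun w => g i (Complex.exp w)) w =
      deriv (g i) (Complex.exp w) * Complex.exp w :=
    ((hg i _).hasDerivAt.comp w (Complex.hasDerivAt_exp w)).deriv
  have hw : weight (fun i w => g i (Complex.exp w)) w = weight g (Complex.exp w) := rfl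
  simp only [spread, gram, hd, hw, ← mul_assoc, ← Finset.sum_mul, norm_mul, mul_pow]
  ring

theorem exists_polynomial_of_spread_le {g : ι → ℂ → ℂ} (hg : ∀ i, Differentiable ℂ (g i)) (i₀ : ι)
    (h₀ : ∀ z, g i₀ z = 0) {m : ℕ} {C : ℝ}
    (hC : ∀ z : ℂ, 1 ≤ ‖z‖ → spread g z ≤ C * ‖z‖ ^ m) (i : ι) :
    ∃ p : Polynomial ℂ, ∀ z, g i z = p.eval z := by
  have : Nonempty ι := ⟨i₀⟩
  set G : ι → ℂ → ℂ := fun i w => g i (Complex.exp w) with hGdef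
  have hG (i : ι) : Differentiable ℂ (G i) := (hg i).comp Complex.differentiable_exp
  have hper (i : ι) (z : ℂ) : G i (z + (2 * Real.pi : ℝ) * Complex.I) = G i z := by
    simp only [hGdef]
    push_cast
    rw [Complex.exp_periodic]
  -- The rate is `m + 2` because the substitution `z = e^w` multiplies the variance by `|e^w|²`.
  obtain ⟨A, hA⟩ := exists_integral_log_sum_weight_le hG (T := 2 * Real.pi) (by positivity) hper
    (C := C) (q := m + 2) (by positivity) (by
      intro z hz
      have hn : ‖Complex.exp z‖ = Real.exp z.re := Complex.norm_exp z
      have h1 : 1 ≤ ‖Complex.exp z‖ := by rw [hn]; exact Real.one_le_exp hz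
      rw [spread_comp_exp hg]
      refine (mul_le_mul_of_nonneg_left (hC _ h1) (sq_nonneg _)).trans_eq ?_
      have : Real.exp (((m : ℝ) + 2) * z.re) = Real.exp z.re ^ m * Real.exp z.re ^ 2 := by
        rw [← Real.exp_nat_mul, ← Real.exp_nat_mul, ← Real.exp_add]
        congr 1
        push_cast
        ring
      rw [this, hn]
      ring)
  refine exists_polynomial_of_integral_re_le (hg i) (A := A) (K := m + 4) fun r hr => ?_
  have hr0 : 0 < r := by linarith
  have hpow : Real.exp (((m : ℝ) + 2 + 2) * Real.log r) = r ^ (m + 4) := by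
    rw [← Real.rpow_natCast, Real.rpow_def_of_pos hr0]
    congr 1
    push_cast
    ring
  have hAr := hA (Real.log r) (Real.log_nonneg hr)
  rw [hpow] at hAr
  refine le_trans ?_ hAr
  have hcm (θ : ℝ) : Complex.exp (Real.log r + θ * Complex.I) = circleMap 0 r θ := by
    rw [Complex.exp_add, ← Complex.ofReal_exp, Real.exp_log hr0, circleMap, zero_add]
  have hc₁ : Continuous fun θ => max (g i (circleMap 0 r θ)).re 0 :=
    (Complex.continuous_re.comp ((hg i).continuous.comp (continuous_circleMap 0 r))).max
      continuous_const
  have hc₂ : Continuous fun θ : ℝ =>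
      Real.log (∑ i, weight G (Real.log r + θ * Complex.I) i) := by
    refine Continuous.log (continuous_finsetSum _ fun j _ => ?_)
      fun θ => (sum_weight_pos G _).ne'
    exact (continuous_weight hG j).comp (by fun_prop)
  refine intervalIntegral.integral_mono_on (by positivity) (hc₁.intervalIntegrable _ _)
    (hc₂.intervalIntegrable _ _) fun θ _ => ?_
  -- Taking `j = i₀` shows that the logarithm is nonnegative, so it bounds the positive part of `Re
  -- (g i)` as well.
  have hle (j : ι) : 2 * (g j (circleMap 0 r θ)).re ≤
      Real.log (∑ i, weight G (Real.log r + θ * Complex.I) i) := by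
    rw [Real.le_log_iff_exp_le (sum_weight_pos G _), ← hcm]
    exact Finset.single_le_sum (f := weight G (Real.log r + θ * Complex.I))
      (fun j _ => (weight_pos G _ j).le) (Finset.mem_univ j)
  have h0 := hle i₀
  rw [h₀, Complex.zero_re, mul_zero] at h0
  refine max_le ?_ h0
  linarith [hle i]

theorem spread_le_sum_norm_sq [Nonempty ι] (g : ι → ℂ → ℂ) (z : ℂ) :
    spread g z ≤ ∑ i, ‖deriv (g i) z‖ ^ 2 := by
  rw [spread, div_le_iff₀ (pow_pos (sum_weight_pos g z) 2), mul_comm]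
  exact gram_le (fun i => (weight_pos g z i).le) _

end Growth

end TorusCurve

open TorusCurve

theorem theorem1 (n : ℕ) (f : ℂ → TorusCurve.CP n) (hf : TorusCurve.IsHolomorphic f)
    (hX : ∀ z, f z ∈ TorusCurve.torus n) (m : ℕ) :
    (∃ C : ℝ, 0 < C ∧ ∀ z : ℂ, 1 ≤ ‖z‖ → TorusCurve.normDiff f z ≤ C * ‖z‖ ^ m) ↔
      ∃ g : Fin n → Polynomial ℂ, (∀ i, (g i).natDegree ≤ m + 1) ∧
        ∀ z : ℂ, f z = TorusCurve.point fun i => Complex.exp ((g i).eval z) := by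
  constructor
  · rintro ⟨C, hC0, hC⟩
    obtain ⟨g, hgd, hg⟩ := hf.exists_eq_point_exp hX
    have hspread (z : ℂ) (hz : 1 ≤ ‖z‖) :
        spread (exponents g) z ≤ (√Real.pi * C * ‖z‖ ^ m) ^ 2 := by
      have h := hC z hz
      rw [normDiff_eq hgd hg, Real.sqrt_le_left (by positivity), div_le_iff₀ Real.pi_pos] at h
      rw [mul_assoc, mul_pow, Real.sq_sqrt Real.pi_pos.le]
      linarith
    have hed (i : Fin (n + 1)) : Differentiable ℂ (exponents g i) := by
      refine Fin.cases ?_ (fun j => ?_) i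
      · exact differentiable_const 0
      · exact hgd j
    -- The variance is quadratic in `|df|`, hence the exponent `m * 2`. Only polynomiality is kept
    -- here; the degree comes from `natDegree_le_of_gram_le`.
    have hpoly (i : Fin n) : ∃ p : Polynomial ℂ, ∀ z, g i z = p.eval z :=
      exists_polynomial_of_spread_le hed 0 (fun z => rfl) (m := m * 2) (C := (√Real.pi * C) ^ 2)
        (fun z hz => (hspread z hz).trans_eq (by rw [mul_pow, pow_mul])) i.succ
    choose p hp using hpoly
    obtain rfl : g = fun i z => (p i).eval z := funext fun i => funext (hp i)
    refine ⟨p, fun i => ?_, hg⟩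
    refine natDegree_le_of_gram_le (Fin.cons 0 p : Fin (n + 1) → Polynomial ℂ) 0 rfl
      (m := m) (C := √Real.pi * C) (fun z hz => ?_) i.succ
    have h := hspread z hz
    rw [exponents_eval, spread, div_le_iff₀ (pow_pos (sum_weight_pos _ z) 2)] at h
    simpa only [Polynomial.deriv, weight] using! h
  · rintro ⟨g, hdeg, hg⟩
    set c : Fin n → ℝ := fun i => ∑ k ∈ Finset.range (m + 1), ‖(g i).derivative.coeff k‖ with hc
    -- The summand 1 only ensures `C > 0`, for instance when all `g i` are constant.
    set C : ℝ := √(∑ i, c i ^ 2) + 1 with hCdef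
    refine ⟨C, by positivity, fun z hz => ?_⟩
    rw [normDiff_eq (fun i => (g i).differentiable) hg, Real.sqrt_le_left (by positivity)]
    have hsp := spread_le_sum_norm_sq (exponents fun i z => (g i).eval z) z
    have hpi : spread (exponents fun i z => (g i).eval z) z / Real.pi ≤
        spread (exponents fun i z => (g i).eval z) z :=
      div_le_self (spread_nonneg _ _) (by linarith [Real.pi_gt_three])
    refine (hpi.trans hsp).trans ?_
    rw [Fin.sum_univ_succ]
    have hzero : deriv (exponents (fun i z => (g i).eval z) 0) z = 0 := deriv_const z (0 : ℂ)
    rw [hzero, norm_zero, zero_pow two_ne_zero, zero_add]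
    have hterm (i : Fin n) : ‖deriv (exponents (fun i z => (g i).eval z) i.succ) z‖ ^ 2 ≤
        c i ^ 2 * (‖z‖ ^ m) ^ 2 := by
      have h₁ : deriv (exponents (fun i z => (g i).eval z) i.succ) z = (g i).derivative.eval z :=
        (g i).deriv
      rw [h₁, ← mul_pow]
      refine pow_le_pow_left₀ (norm_nonneg _) (norm_eval_le_of_natDegree_le ?_ hz) 2
      exact (Polynomial.natDegree_derivative_le _).trans (by have := hdeg i; omega)
    refine (Finset.sum_le_sum fun i _ => hterm i).trans ?_
    rw [← Finset.sum_mul, mul_pow]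
    refine mul_le_mul_of_nonneg_right ?_ (sq_nonneg _)
    have hs := Real.sq_sqrt (Finset.sum_nonneg fun i (_ : i ∈ Finset.univ) => sq_nonneg (c i))
    nlinarith [Real.sqrt_nonneg (∑ i, c i ^ 2)]
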